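/- **Circuits.** Let $p,q$ be primes, $n\ge 13$ and $1\le d\le n$. An $n$-input $\mathrm{AND}_d\circ\mathrm{MOD}_p\circ\mathrm{MOD}_q$ circuit is a layered directed acyclic multigraph consisting of input gates $x_1,\dots,x_n$; a first level of finitely many $\mathrm{AND}$ gates, each wired to at most $d$ input gates; a second level of finitely many $\mathrm{MOD}_p^{R}$ gates that receive wires from the first level, where each gate has its own accepting set $R\subseteq\mathbb F_p$; and a single output gate $\mathrm{MOD}_q^{R}$, $R\subseteq\mathbb F_q$, that receives wires from the second level. Several parallel wires between the same two gates are allowed. A $\mathrm{MOD}_m^{R}$ gate outputs $1$ if the sum modulo $m$ of the values on its incoming wires lies in $R$, and $0$ otherwise. The size of a circuit is its number of non-input gates. The circuit is symmetric if every permutation of the input gates extends to a permutation of all gates that preserves the levels, the accepting sets, and the number of wires from any gate to any other gate. **Theorem.** Let $f:\{0,1\}^n\to\{0,1\}$ be the function computed by a symmetric $n$-input $\mathrm{AND}_d\circ\mathrm{MOD}_p\circ\mathrm{MOD}_q$ circuit of size $s<2^{n/9}$. Then $f(x)$ depends only on the Hamming weight of $x$. Moreover, writing $f(m)=f(1^m0^{n-m})$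 for $0\le m\le n$, for all integers $k_p,k_q\ge 0$ with $p^{k_p}>d$ and $q^{k_q}>\log_2 s+1$ the number $r=p^{k_p}q^{k_q}$ is a period of $f$, that is, $f(m+r)=f(m)$ for all integers $m$ with $0\le m\le n-r$. -/

import Mathlib

/-- An `n`-input `AND_d ∘ MOD_p ∘ MOD_q` circuit: a layered directed acyclic multigraph with input
gates `x_0, …, x_{n-1}`, a first level of `AND` gates, a second level of `MOD_p^R` gates and a
single `MOD_q^R` output gate.  Wires run between consecutive levels only, and the natural numbers
`inWires`, `midWires`, `outWires` are the numbers of parallel wires between two gates. -/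
structure AndModModCircuit (n d p q : ℕ) where
  /-- number of `AND` gates (level 1) -/
  numAnd : ℕ
  /-- number of `MOD_p` gates (level 2) -/
  numMod : ℕ
  /-- wires from the input gates to the `AND` gates -/
  inWires : Fin n → Fin numAnd → ℕ
  /-- wires from the `AND` gates to the `MOD_p` gates -/
  midWires : Fin numAnd → Fin numMod → ℕ
  /-- wires from the `MOD_p` gates to the output gate -/
  outWires : Fin numMod → ℕ
  /-- accepting sets of the `MOD_p` gates -/
  accept : Fin numMod → Finset (ZMod p)
  /-- accepting set of the output gate -/
  acceptOut : Finset (ZMod q)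
  /-- every `AND` gate receives inputs from at most `d` input gates -/
  andFanIn : ∀ g, (Finset.univ.filter fun i => inWires i g ≠ 0).card ≤ d

namespace AndModModCircuit

variable {n d p q : ℕ}

/-- The size of a circuit: its number of non-input gates. -/
def size (C : AndModModCircuit n d p q) : ℕ := C.numAnd + C.numMod + 1

/-- The value of an `AND` gate: the conjunction of all input gates wired to it. -/
def andValue (C : AndModModCircuit n d p q) (x : Fin n → Bool) (g : Fin C.numAnd) : Bool :=
  decide (∀ i, C.inWires i g ≠ 0 → x i = true)

/-- The value of a `MOD_p^R` gate: whether the sum modulo `p` over its incoming wires is in `R`. -/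
def modValue (C : AndModModCircuit n d p q) (x : Fin n → Bool) (h : Fin C.numMod) : Bool :=
  decide (((∑ g, C.midWires g h * (C.andValue x g).toNat : ℕ) : ZMod p) ∈ C.accept h)

/-- The function computed by the circuit: the value of the `MOD_q^R` output gate. -/
def eval (C : AndModModCircuit n d p q) (x : Fin n → Bool) : Bool :=
  decide (((∑ h, C.outWires h * (C.modValue x h).toNat : ℕ) : ZMod q) ∈ C.acceptOut)

/-- A circuit is symmetric if every permutation `π` of the input gates extends to an automorphism
of the circuit, that is, to a permutation of all gates that preserves the levels, the accepting
sets, and the number of wires between any two gates.  Such a permutation consists of `π`, a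
permutation `σ` of the `AND` gates and a permutation `τ` of the `MOD_p` gates, and it fixes the
output gate. -/
def IsSymmetric (C : AndModModCircuit n d p q) : Prop :=
  ∀ π : Equiv.Perm (Fin n), ∃ (σ : Equiv.Perm (Fin C.numAnd)) (τ : Equiv.Perm (Fin C.numMod)),
    (∀ i g, C.inWires (π i) (σ g) = C.inWires i g) ∧
    (∀ g h, C.midWires (σ g) (τ h) = C.midWires g h) ∧
    (∀ h, C.outWires (τ h) = C.outWires h) ∧
    (∀ h, C.accept (τ h) = C.accept h)

end AndModModCircuit

/-- The Hamming weight of a Boolean vector: its number of ones. -/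
def boolWeight {n : ℕ} (x : Fin n → Bool) : ℕ := (Finset.univ.filter fun i => x i = true).card

/-- The value of `f` depends only on the Hamming weight of its argument. -/
def DependsOnWeight {n : ℕ} (f : (Fin n → Bool) → Bool) : Prop :=
  ∀ x y, boolWeight x = boolWeight y → f x = f y

/-- The vector `1^m 0^(n-m)` (for `m ≤ n`). -/
def onesZeros (n m : ℕ) : Fin n → Bool := fun i => decide ((i : ℕ) < m)

/-- With `f(m) = f(1^m 0^(n-m))`, the positive integer `r` is a period of `f` if
`f(m + r) = f(m)` for all `0 ≤ m ≤ n - r`. -/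
def IsWeightPeriod {n : ℕ} (f : (Fin n → Bool) → Bool) (r : ℕ) : Prop :=
  0 < r ∧ ∀ m, m + r ≤ n → f (onesZeros n (m + r)) = f (onesZeros n m)

/-! Dependence on the weight is invariance under input permutations. For the period, compare `x =
1^m 0^(n-m)` with `y = 1^(m+r) 0^(n-m-r)`, which differ on a block `B` of `r` coordinates. Let `ρ`
permute `B` in cycles of length `q^kq`, fix all other coordinates, and lift it to an automorphism
acting on the `MOD_p` gates by `τ` of `q`-power order (`IsSymmetric.exists_automorphism`). Since `ρ`
fixes `x` and `y`, the gates moved by `τ` cancel modulo `q` (`sum_eq_zero_of_perm_pow_prime`). It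
remains to see that a gate fixed by `τ` has the same value on `x` and `y`.

The stabilizer `H` of the sum at such a gate contains `ρ` and has index at most `s`. By
`exists_large_invariant_class` there is an `H`-invariant set `D` of at most `log₂ s` points such
that any two distinct points outside `D` are moved by a common three-cycle of `H`. On Boolean inputs
three-cycle symmetries yield transpositions (`swap_mem_cubeStabilizer`), so the sum is symmetric in
the coordinates outside `D`. The cycles of `ρ` on `B` are longer than `|D|`, hence `D` misses `B`.
On `B` the sum is then a symmetric polynomial of degree at most `d` over `F_p`, of the form `∑ e_i *
(w choose i)` in the weight `w`; as `p^kp > d` divides `|B|`, its values at `w = 0` and `w = |B|`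
agree (`modSum_eq_of_symmetric`). -/

open Equiv

/-! ### Cosets and commutators of permutations -/

/-- A set of permutations lying in pairwise distinct left cosets of `H` has at most
`H.index` elements. -/
theorem card_le_index_of_injective_cosets {α ι : Type*} [Finite α] [Fintype ι]
    (H : Subgroup (Perm α)) (g : ι → Perm α) (hg : ∀ i j, (g i)⁻¹ * g j ∈ H → i = j) :
    Fintype.card ι ≤ H.index := by
  rw [← Nat.card_eq_fintype_card, Subgroup.index]
  refine Nat.card_le_card_of_injective (fun i => (g i : Perm α ⧸ H)) ?_
  intro i j hij
  exact hg i j (QuotientGroup.eq.1 hij)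

theorem apply_ne_of_inter_support {α : Type*} {g h : Perm α} {c : α} (hg : g c ≠ c)
    (hh : h c ≠ c) (hgh : ∀ a, a ≠ c → g a = a ∨ h a = a) : h c ≠ g c := by
  intro e
  rcases hgh (g c) hg with h1 | h1
  · exact hg (g.injective h1)
  · rw [← e] at h1
    exact hh (h.injective h1)

/-- Two permutations whose supports meet in exactly one point have a three-cycle as their
commutator. -/
theorem commutator_eq_swap_mul_swap {α : Type*} [DecidableEq α] {g h : Perm α} {c : α}
    (hg : g c ≠ c) (hh : h c ≠ c) (hgh : ∀ a, a ≠ c → g a = a ∨ h a = a) :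
    g * h * g⁻¹ * h⁻¹ = swap c (h c) * swap c (g c) := by
  -- Without inverses the two sides can be compared point by point.
  have key : g * h = swap c (h c) * swap c (g c) * h * g := by
    ext a
    simp only [Perm.mul_apply]
    have h1 : h (g c) = g c := (hgh _ hg).resolve_left fun e => hg (g.injective e)
    have h2 : g (h c) = h c := (hgh _ hh).resolve_right fun e => hh (h.injective e)
    have hne := apply_ne_of_inter_support hg hh hgh
    by_cases hac : a = c
    · rw [hac, h1, h2, swap_apply_right, swap_apply_left]
    by_cases hga : g a = a
    · rw [hga]
      by_cases hhc : h a = c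
      · rw [hhc, swap_apply_left, swap_apply_of_ne_of_ne hg hne.symm]
      · have e1 : h a ≠ g c := fun e => hg (by
          have := h.injective (e.trans h1.symm)
          rw [this] at hga
          exact g.injective hga)
        have e2 : h a ≠ h c := fun e => hac (h.injective e)
        rw [swap_apply_of_ne_of_ne hhc e1, swap_apply_of_ne_of_ne hhc e2]
        rcases hgh _ hhc with e | e
        · exact e
        · rw [h.injective e, hga]
    · have hha : h a = a := (hgh a hac).resolve_left hga
      rw [hha]
      by_cases hgc : g a = c
      · rw [hgc, swap_apply_of_ne_of_ne hh hne, swap_apply_right]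
      · have e1 : g a ≠ g c := fun e => hac (g.injective e)
        have e2 : g a ≠ h c := fun e => hga (by
          have := g.injective (e.trans h2.symm)
          rw [this] at hha
          exact absurd (h.injective hha) hh)
        have e3 : h (g a) = g a := (hgh _ hgc).resolve_left fun e => hga (g.injective e)
        rw [e3, swap_apply_of_ne_of_ne hgc e1, swap_apply_of_ne_of_ne hgc e2]
  rw [key]; group

/-! ### Subgroups of small index in the symmetric group -/

section SmallIndex

variable {α : Type*} [Fintype α] [DecidableEq α]

/-- For finsets `V, V' ⊆ W` of the same size, some permutation supported in `W` maps `V`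
onto `V'`. -/
theorem exists_perm_map_eq {W V V' : Finset α} (hV : V ⊆ W) (hV' : V' ⊆ W)
    (hc : V.card = V'.card) :
    ∃ g : Perm α, (∀ a, a ∉ W → g a = a) ∧ ∀ a, g a ∈ V' ↔ a ∈ V := by
  have e1 : {x // x ∈ V} ≃ {x // x ∈ V'} := Fintype.equivOfCardEq (by simpa using hc)
  have hc2 : (W \ V).card = (W \ V').card := by
    rw [Finset.card_sdiff_of_subset hV, Finset.card_sdiff_of_subset hV', hc]
  have e2 : {x // x ∈ W \ V} ≃ {x // x ∈ W \ V'} := Fintype.equivOfCardEq (by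
    rw [Fintype.card_coe, Fintype.card_coe, hc2])
  let f : α → α := fun a =>
    if h : a ∈ V then e1 ⟨a, h⟩ else if h : a ∈ W \ V then e2 ⟨a, h⟩ else a
  have f1 : ∀ a (h : a ∈ V), f a = e1 ⟨a, h⟩ := fun a h => by simp only [f, dif_pos h]
  have f2 : ∀ a (h : a ∈ W \ V), f a = e2 ⟨a, h⟩ := fun a h => by
    have : a ∉ V := (Finset.mem_sdiff.1 h).2
    simp only [f, dif_neg this, dif_pos h]
  have f3 : ∀ a, a ∉ W → f a = a := fun a h => by
    have h1 : a ∉ V := fun h' => h (hV h')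
    have h2 : a ∉ W \ V := fun h' => h (Finset.mem_sdiff.1 h').1
    simp only [f, dif_neg h1, dif_neg h2]
  have m1 : ∀ a, a ∈ V → f a ∈ V' := fun a h => by rw [f1 a h]; exact (e1 _).2
  have m2 : ∀ a, a ∈ W \ V → f a ∈ W \ V' := fun a h => by rw [f2 a h]; exact (e2 _).2
  have tri : ∀ a, a ∈ V ∨ a ∈ W \ V ∨ a ∉ W := fun a => by
    by_cases h1 : a ∈ V <;> by_cases h2 : a ∈ W <;> simp [h1, h2]
  have inj : Function.Injective f := by
    intro a b hab
    rcases tri a with ha | ha | ha <;> rcases tri b with hb | hb | hb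
    · rw [f1 a ha, f1 b hb] at hab
      simpa using e1.injective (Subtype.ext hab)
    · have := m1 a ha; have := m2 b hb; grind
    · have := m1 a ha; have := f3 b hb; grind
    · have := m2 a ha; have := m1 b hb; grind
    · rw [f2 a ha, f2 b hb] at hab
      simpa using e2.injective (Subtype.ext hab)
    · have := m2 a ha; have := f3 b hb; grind
    · have := f3 a ha; have := m1 b hb; grind
    · have := f3 a ha; have := m2 b hb; grind
    · rwa [f3 a ha, f3 b hb] at hab
  refine ⟨Equiv.ofBijective f (Finite.injective_iff_bijective.1 inj), fun a ha => f3 a ha, ?_⟩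
  intro a
  simp only [Equiv.ofBijective_apply]
  refine ⟨fun h => ?_, m1 a⟩
  rcases tri a with ha | ha | ha
  · exact ha
  · exact absurd h (Finset.mem_sdiff.1 (m2 a ha)).2
  · rw [f3 a ha] at h
    have haW := hV' h
    exact absurd haW ha

/-- If every element of `H` that fixes the complement of `W` pointwise leaves `V ⊆ W` invariant,
then `H` has index at least `|W|.choose |V|`. -/
theorem choose_le_index (H : Subgroup (Perm α)) {W V : Finset α} (hV : V ⊆ W)
    (hH : ∀ g ∈ H, (∀ a, a ∉ W → g a = a) → ∀ a ∈ V, g a ∈ V) :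
    W.card.choose V.card ≤ H.index := by
  -- One coset per `|V|`-subset `S` of `W`: if `(g S)⁻¹ * g T` lies in `H`, it preserves `V`, which
  -- forces `T ⊆ S`.
  have key : ∀ S : {S // S ∈ W.powersetCard V.card},
      ∃ g : Perm α, (∀ a, a ∉ W → g a = a) ∧ ∀ a, g a ∈ S.1 ↔ a ∈ V := fun S =>
    exists_perm_map_eq hV (Finset.mem_powersetCard.1 S.2).1 (Finset.mem_powersetCard.1 S.2).2.symm
  choose g hgW hg using key
  have := card_le_index_of_injective_cosets H g (fun S T hST => by
    have hfix : ∀ a, a ∉ W → ((g S)⁻¹ * g T) a = a := fun a ha => by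
      rw [Perm.mul_apply, hgW T a ha, Perm.inv_eq_iff_eq, hgW S a ha]
    have hsub : T.1 ⊆ S.1 := fun b hb => by
      have hb' : (g T)⁻¹ b ∈ V := by rw [← hg T]; simpa using hb
      have := hH _ hST hfix _ hb'
      rw [← hg S] at this
      simpa using this
    refine Subtype.ext (Finset.eq_of_subset_of_card_le hsub ?_).symm
    rw [(Finset.mem_powersetCard.1 S.2).2, (Finset.mem_powersetCard.1 T.2).2])
  rwa [Fintype.card_coe, Finset.card_powersetCard] at this

/-- If no nontrivial element of `H` is supported in `Y`, then `H` has index at least `|Y|!`. -/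
theorem factorial_le_index (H : Subgroup (Perm α)) {Y : Finset α}
    (hH : ∀ g ∈ H, (∀ a, a ∉ Y → g a = a) → g = 1) : Y.card.factorial ≤ H.index := by
  have := card_le_index_of_injective_cosets H
    (fun e : Perm {x // x ∈ Y} => Perm.ofSubtype e) (fun e f hef => by
      have h1 := hH _ hef (fun a ha => by
        rw [← map_inv, ← map_mul]
        exact Perm.ofSubtype_apply_of_not_mem _ ha)
      rw [inv_mul_eq_one] at h1
      exact Perm.ofSubtype_injective h1)
  simpa [Fintype.card_perm] using this

/-- Bochert's argument: if `H` contains no three-cycle supported in `X`, then its index is at least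
`⌈|X| / 2⌉!`. -/
theorem factorial_half_le_index (H : Subgroup (Perm α)) {X : Finset α}
    (hX : ∀ g ∈ H, g.IsThreeCycle → ¬ g.support ⊆ X) :
    ((X.card + 1) / 2).factorial ≤ H.index := by
  classical
  let free : Finset α → Prop := fun Y => ∀ g ∈ H, (∀ a, a ∉ Y → g a = a) → g = 1
  have hne : (X.powerset.filter free).Nonempty := by
    refine ⟨∅, ?_⟩
    simp only [Finset.mem_filter, Finset.empty_mem_powerset, true_and, free]
    intro g _ hg
    ext a
    exact hg a (by simp)
  obtain ⟨Y, hY, hmax⟩ := Finset.exists_max_image _ Finset.card hne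
  simp only [Finset.mem_filter, Finset.mem_powerset] at hY hmax
  obtain ⟨hYX, hYf⟩ := hY
  refine le_trans (Nat.factorial_le ?_) (factorial_le_index H hYf)
  -- Otherwise `X \ Y` is larger than `Y`, so by maximality neither it nor `insert c Y` is free,
  -- where `c` is a point moved by some `g ∈ H` supported in `X \ Y`. The resulting `g` and `h` have
  -- supports meeting only in `c`, and their commutator is a forbidden three-cycle.
  by_contra! hlt
  have hc : (X \ Y).card = X.card - Y.card := Finset.card_sdiff_of_subset hYX
  have h1 : ¬ free (X \ Y) := fun h => by
    have := hmax _ ⟨Finset.sdiff_subset, h⟩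
    omega
  simp only [free] at h1
  push Not at h1
  obtain ⟨g, hgH, hgs, hg1⟩ := h1
  obtain ⟨c, hc⟩ : ∃ c, g c ≠ c := by
    by_contra! h
    exact hg1 (Equiv.ext h)
  have hcX : c ∈ X \ Y := by
    by_contra h
    exact hc (hgs c h)
  obtain ⟨hcX, hcY⟩ := Finset.mem_sdiff.1 hcX
  have h2 : ¬ free (insert c Y) := fun h => by
    have := hmax _ ⟨Finset.insert_subset hcX hYX, h⟩
    rw [Finset.card_insert_of_notMem hcY] at this
    omega
  simp only [free] at h2
  push Not at h2
  obtain ⟨h, hhH, hhs, hh1⟩ := h2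
  have hhc : h c ≠ c := fun e => hh1 (hYf h hhH fun a ha => by
    by_cases hac : a = c
    · rw [hac, e]
    · exact hhs a (by simp [hac, ha]))
  have hgh : ∀ a, a ≠ c → g a = a ∨ h a = a := fun a hac => by
    by_cases haY : a ∈ Y
    · exact Or.inl (hgs a (by simp [haY]))
    · exact Or.inr (hhs a (by simp [hac, haY]))
  have hk := commutator_eq_swap_mul_swap hc hhc hgh
  have hne := apply_ne_of_inter_support hc hhc hgh
  refine hX (g * h * g⁻¹ * h⁻¹)
    (H.mul_mem (H.mul_mem (H.mul_mem hgH hhH) (H.inv_mem hgH)) (H.inv_mem hhH)) ?_ ?_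
  · rw [hk]
    exact Perm.isThreeCycle_swap_mul_swap_same hhc.symm hc.symm hne
  · intro a ha
    by_contra haX
    have hga : g a = a := hgs a (fun h' => haX (Finset.mem_sdiff.1 h').1)
    have hha : h a = a := hhs a (fun h' => haX (Finset.insert_subset hcX hYX h'))
    have e1 : g⁻¹ a = a := by rw [Perm.inv_eq_iff_eq, hga]
    have e2 : h⁻¹ a = a := by rw [Perm.inv_eq_iff_eq, hha]
    rw [Perm.mem_support] at ha
    exact ha (by simp only [Perm.mul_apply, e1, e2, hga, hha])

/-- Two points are related if they are equal or lie in the support of a common three-cycle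
of `H`. -/
def threeCycleSetoid (H : Subgroup (Perm α)) : Setoid α where
  r a b := a = b ∨ ∃ g ∈ H, g.IsThreeCycle ∧ a ∈ g.support ∧ b ∈ g.support
  iseqv := by
    refine ⟨fun a => Or.inl rfl, ?_, ?_⟩
    · rintro a b (h | ⟨g, h1, h2, h3, h4⟩)
      · exact Or.inl h.symm
      · exact Or.inr ⟨g, h1, h2, h4, h3⟩
    · rintro a b c (rfl | ⟨g, h1, h2, h3, h4⟩) hbc
      · exact hbc
      · rcases hbc with rfl | ⟨k, k1, k2, k3, k4⟩
        · exact Or.inr ⟨g, h1, h2, h3, h4⟩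
        -- If `k` fixes `a`, conjugating `g` by a power of `k` that sends `b` to `c` gives a
        -- three-cycle moving both `a` and `c`.
        · by_cases hka : a ∈ k.support
          · exact Or.inr ⟨k, k1, k2, hka, k4⟩
          · obtain ⟨i, hi⟩ := k2.isCycle.exists_zpow_eq (Perm.mem_support.1 k3)
              (Perm.mem_support.1 k4)
            have hia : (k ^ i) a = a := Perm.zpow_apply_eq_self_of_apply_eq_self
              (Perm.notMem_support.1 hka) i
            have hmem : ∀ x ∈ g.support, (k ^ i) x ∈ (k ^ i * g * (k ^ i)⁻¹).support := by
              intro x hx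
              rw [Perm.mem_support] at hx ⊢
              simpa [Perm.mul_apply] using hx
            refine Or.inr ⟨k ^ i * g * (k ^ i)⁻¹, H.mul_mem (H.mul_mem (H.zpow_mem k1 i) h1)
              (H.inv_mem (H.zpow_mem k1 i)), ?_, ?_, ?_⟩
            · rw [Perm.IsThreeCycle, Perm.cycleType_conj]
              exact h2
            · have := hmem a h3
              rwa [hia] at this
            · have := hmem b h4
              rwa [hi] at this

theorem threeCycleSetoid_apply {H : Subgroup (Perm α)} {k : Perm α} (hk : k ∈ H) {a b : α}
    (hab : threeCycleSetoid H a b) : threeCycleSetoid H (k a) (k b) := by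
  rcases hab with rfl | ⟨g, h1, h2, h3, h4⟩
  · exact Or.inl rfl
  · refine Or.inr ⟨k * g * k⁻¹, H.mul_mem (H.mul_mem hk h1) (H.inv_mem hk), ?_, ?_, ?_⟩
    · rw [Perm.IsThreeCycle, Perm.cycleType_conj]
      exact h2
    · rw [Perm.mem_support] at h3 ⊢
      simpa [Perm.mul_apply] using h3
    · rw [Perm.mem_support] at h4 ⊢
      simpa [Perm.mul_apply] using h4

theorem two_pow_le_choose {n k : ℕ} (h : 2 * k ≤ n) : 2 ^ k ≤ n.choose k := by
  refine le_trans ?_ (Nat.choose_le_choose k h)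
  change 2 ^ k ≤ k.centralBinom
  clear h
  induction k with
  | zero => simp
  | succ k ih =>
    have := Nat.succ_mul_centralBinom_succ k
    have h2 : (k + 1) * 2 ^ (k + 1) ≤ (k + 1) * (k + 1).centralBinom := by
      rw [this, pow_succ]
      nlinarith
    exact Nat.le_of_mul_le_mul_left h2 (by omega)

theorem two_pow_le_factorial_succ (m : ℕ) : 2 ^ m ≤ (m + 1).factorial := by
  simpa [add_comm] using Nat.factorial_mul_pow_le_factorial (m := 1) (n := m)

/-- A subgroup of small index has a class of `threeCycleSetoid` that it leaves invariant and that
contains all but logarithmically many points. -/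
theorem exists_large_invariant_class (H : Subgroup (Perm α)) {s : ℕ} (hs : H.index ≤ s)
    (hn : 13 ≤ Fintype.card α) (hsn : s ^ 9 < 2 ^ Fintype.card α) :
    ∃ D : Finset α, 2 ^ D.card ≤ s ∧ (∀ g ∈ H, ∀ a ∈ D, g a ∈ D) ∧
      ∀ a b, a ∉ D → b ∉ D → threeCycleSetoid H a b := by
  classical
  set n := Fintype.card α with hndef
  set r := threeCycleSetoid H with hr
  have hs0 : s ≠ 0 := fun h => by
    have : H.index ≠ 0 := Subgroup.index_ne_zero_of_finite
    omega
  set L := Nat.log 2 s with hL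
  -- With `n ≥ 13` this gives the two estimates used below: `n > 5L + 2`, so that `|W| > 3L`, and `n
  -- > 6L + 4`, so that the large class has more than `n / 2` points.
  have hLn : 9 * L < n := by
    have h1 : 2 ^ L ≤ s := Nat.pow_log_le_self 2 hs0
    have h2 : 2 ^ (9 * L) < 2 ^ n := by
      calc 2 ^ (9 * L) = (2 ^ L) ^ 9 := by rw [← pow_mul, mul_comm]
        _ ≤ s ^ 9 := Nat.pow_le_pow_left h1 9
        _ < 2 ^ n := hsn
    exact (Nat.pow_lt_pow_iff_right (by norm_num)).1 h2
  have hlog : ∀ k, 2 ^ k ≤ s → k ≤ L := fun k hk => Nat.le_log_of_pow_le (by norm_num) hk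
  -- a transversal of the classes
  let rep : α → α := fun a => (Quotient.mk r a).out
  have hrep : ∀ a, r (rep a) a := fun a => Quotient.exact (Quotient.out_eq (Quotient.mk r a))
  have hrep_eq : ∀ a b, r a b → rep a = rep b := fun a b h => by
    simp only [rep, Quotient.sound (s := r) h]
  let T : Finset α := Finset.univ.image rep
  -- The support of a three-cycle of `H` lies in one class, whereas `T` meets each class once; so
  -- Bochert's bound applies to `T`.
  have hT : T.card ≤ 2 * L + 2 := by
    have h1 := factorial_half_le_index H (X := T) (fun g hg h3 hsub => by
      obtain ⟨a, ha⟩ : g.support.Nonempty := by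
        rw [← Finset.card_pos, h3.card_support]; norm_num
      have hga : g a ∈ g.support := Perm.apply_mem_support.2 ha
      obtain ⟨u, -, hu⟩ := Finset.mem_image.1 (hsub ha)
      obtain ⟨v, -, hv⟩ := Finset.mem_image.1 (hsub hga)
      have huv : r u v := by
        have h4 : r a (g a) := Or.inr ⟨g, hg, h3, ha, hga⟩
        have h5 := hrep u
        have h6 := hrep v
        rw [hu] at h5
        rw [hv] at h6
        exact r.trans (r.symm h5) (r.trans h4 h6)
      have := hrep_eq u v huv
      rw [hu, hv] at this
      exact Perm.mem_support.1 ha this.symm)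
    by_contra! hcon
    have h2 : L + 1 ≤ (T.card + 1) / 2 - 1 := by omega
    have h3 := two_pow_le_factorial_succ (L + 1)
    have h4 : (L + 1 + 1).factorial ≤ ((T.card + 1) / 2).factorial :=
      Nat.factorial_le (by omega)
    have := hlog (L + 1) (h3.trans (h4.trans (h1.trans hs)))
    omega
  let W : Finset α := Tᶜ
  have hW : W.card = n - T.card := Finset.card_compl T
  have hTn : T.card ≤ n := Finset.card_le_univ T
  -- saturated sets are small or cosmall
  have hsat : ∀ V : Finset α, (∀ a b, r a b → a ∈ V → b ∈ V) →
      (W ∩ V).card ≤ L ∨ W.card - (W ∩ V).card ≤ L := by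
    intro V hV
    have h1 := (choose_le_index H (W := W) (V := W ∩ V) Finset.inter_subset_left
      (fun g hg hfix a ha => by
        obtain ⟨haW, haV⟩ := Finset.mem_inter.1 ha
        refine Finset.mem_inter.2 ⟨?_, ?_⟩
        · by_contra h
          have := g.injective (hfix _ h)
          rw [this] at h
          exact h haW
        -- `g` fixes the representative of the class of `a`, hence maps this class to itself.
        · have h2 : rep a ∉ W := by simp [W, T]
          have h3 := threeCycleSetoid_apply hg (hrep a)
          rw [hfix _ h2] at h3
          exact hV _ _ h3 (hV _ _ (r.symm (hrep a)) haV))).trans hs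
    have hle : (W ∩ V).card ≤ W.card := Finset.card_le_card Finset.inter_subset_left
    by_cases h2 : 2 * (W ∩ V).card ≤ W.card
    · exact Or.inl (hlog _ ((two_pow_le_choose h2).trans h1))
    · rw [← Nat.choose_symm hle] at h1
      exact Or.inr (hlog _ ((two_pow_le_choose (by omega)).trans h1))
  -- a class containing most of `W`
  obtain ⟨w, hw⟩ : ∃ w, W.card - (W ∩ Finset.univ.filter (r w)).card ≤ L := by
    by_contra! hcon
    have hcl : ∀ w a b, r a b → a ∈ Finset.univ.filter (r w) → b ∈ Finset.univ.filter (r w) := by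
      intro w a b hab ha
      simp only [Finset.mem_filter, Finset.mem_univ, true_and] at ha ⊢
      exact r.trans ha hab
    have hsmall : ∀ w, (W ∩ Finset.univ.filter (r w)).card ≤ L := fun w =>
      (hsat _ (hcl w)).resolve_right (by have := hcon w; omega)
    -- Enlarging a maximal small saturated set by one class gives at most `2L < |W| - L` points of
    -- `W`, so the union is small again, contradicting maximality.
    let 𝒱 : Finset (Finset α) := Finset.univ.filter fun V =>
      (∀ a b, r a b → a ∈ V → b ∈ V) ∧ (W ∩ V).card ≤ L
    obtain ⟨V, hV, hmax⟩ := Finset.exists_max_image 𝒱 Finset.card ⟨∅, by simp [𝒱]⟩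
    simp only [𝒱, Finset.mem_filter, Finset.mem_univ, true_and] at hV hmax
    obtain ⟨w, hwW, hwV⟩ : ∃ w ∈ W, w ∉ V := by
      by_contra! h
      have : W ∩ V = W := Finset.inter_eq_left.2 h
      rw [this] at hV
      omega
    have hsat' : ∀ a b, r a b → a ∈ V ∪ Finset.univ.filter (r w) →
        b ∈ V ∪ Finset.univ.filter (r w) := by
      intro a b hab ha
      rcases Finset.mem_union.1 ha with h | h
      · exact Finset.mem_union_left _ (hV.1 a b hab h)
      · exact Finset.mem_union_right _ (hcl w a b hab h)
    have hcard : (W ∩ (V ∪ Finset.univ.filter (r w))).card ≤ 2 * L := by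
      rw [Finset.inter_union_distrib_left]
      have := Finset.card_union_le (W ∩ V) (W ∩ Finset.univ.filter (r w))
      have := hsmall w
      omega
    have h3 := (hsat _ hsat').resolve_right (by omega)
    have h4 := hmax _ ⟨hsat', h3⟩
    have h5 : V.card < (V ∪ Finset.univ.filter (r w)).card := by
      refine Finset.card_lt_card ⟨Finset.subset_union_left, fun h => hwV (h ?_)⟩
      exact Finset.mem_union_right _ (by simp)
    omega
  set K : Finset α := Finset.univ.filter (r w) with hK
  have hKmem : ∀ a, a ∈ K ↔ r w a := fun a => by simp [hK]
  have hKcard : n < 2 * K.card := by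
    have : (W ∩ K).card ≤ K.card := Finset.card_le_card Finset.inter_subset_right
    omega
  have hKinv : ∀ g ∈ H, ∀ a, a ∈ K → g a ∈ K := by
    intro g hg a ha
    -- `K` and its image each contain more than half of all points, so they meet.
    obtain ⟨b, hb, hgb⟩ : ∃ b ∈ K, g b ∈ K := by
      by_contra! h
      have hd : Disjoint K (K.image g) := by
        rw [Finset.disjoint_left]
        rintro x hx hx'
        obtain ⟨b, hb, rfl⟩ := Finset.mem_image.1 hx'
        exact h b hb hx
      have h1 := Finset.card_union_of_disjoint hd
      rw [Finset.card_image_of_injective _ g.injective] at h1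
      have h2 := Finset.card_le_univ (K ∪ K.image g)
      omega
    rw [hKmem] at *
    have h1 := threeCycleSetoid_apply hg (r.trans (r.symm hb) ha)
    exact r.trans hgb h1
  refine ⟨Kᶜ, ?_, ?_, ?_⟩
  · have h1 := choose_le_index H (W := Finset.univ) (V := K) (Finset.subset_univ _)
      (fun g hg _ a ha => hKinv g hg a ha)
    rw [Finset.card_univ, ← Nat.choose_symm (Finset.card_le_univ K), ← Finset.card_compl] at h1
    have h2 := Finset.card_compl K
    exact (two_pow_le_choose (by omega)).trans (h1.trans hs)
  · intro g hg a ha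
    rw [Finset.mem_compl] at ha ⊢
    intro h
    have := hKinv _ (H.inv_mem hg) _ h
    exact ha (by simpa using this)
  · intro a b ha hb
    rw [Finset.mem_compl, not_not, hKmem] at ha hb
    exact r.trans (r.symm ha) hb

end SmallIndex

/-! ### Symmetric polynomials of low degree modulo `p` -/

/-- If `p ^ k ∣ N` and `0 < i < p ^ k`, then the prime `p` divides `N.choose i`. -/
theorem prime_dvd_choose_of_pow_dvd {p k N i : ℕ} (hp : p.Prime) (hN : p ^ k ∣ N) (hi : 0 < i)
    (hik : i < p ^ k) : p ∣ N.choose i := by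
  by_contra hnd
  obtain ⟨j, rfl⟩ : ∃ j, i = j + 1 := ⟨i - 1, by omega⟩
  rcases Nat.eq_zero_or_pos N with rfl | hpos
  · simp at hnd
  obtain ⟨M, rfl⟩ : ∃ M, N = M + 1 := ⟨N - 1, by omega⟩
  have h1 := Nat.add_one_mul_choose_eq M j
  have h2 : p ^ k ∣ (M + 1).choose (j + 1) * (j + 1) := h1 ▸ Dvd.dvd.mul_right hN _
  have hcop : Nat.Coprime (p ^ k) ((M + 1).choose (j + 1)) :=
    Nat.Coprime.pow_left k ((Nat.Prime.coprime_iff_not_dvd hp).2 hnd)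
  exact absurd (Nat.le_of_dvd hi (hcop.dvd_of_dvd_mul_left h2)) (by omega)

/-- If the subset sums of `c` over the subsets of `B` depend only on the size of the subset,
then so does `c`. -/
theorem exists_eq_apply_card_of_sum_powerset {α R : Type*} [DecidableEq α] [AddCommGroup R]
    {B : Finset α} {c : Finset α → R} {v : ℕ → R}
    (h : ∀ T ⊆ B, ∑ U ∈ T.powerset, c U = v T.card) (k : ℕ) :
    ∃ e : ℕ → R, ∀ U ⊆ B, U.card < k → c U = e U.card := by
  induction k with
  | zero => exact ⟨0, fun U _ hU => absurd hU (by omega)⟩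
  | succ k ih =>
    obtain ⟨e, he⟩ := ih
    -- The value at `k` is forced by `v k`. The subtracted `e k` removes the arbitrary top term `m =
    -- k`, leaving the sum over proper subsets of a `k`-set.
    refine ⟨fun j => if j < k then e j else
      v k - (∑ m ∈ Finset.range (k + 1), k.choose m • e m - e k), fun U hU hUk => ?_⟩
    by_cases hlt : U.card < k
    · simp only [if_pos hlt]
      exact he U hU hlt
    · have hk : U.card = k := by omega
      simp only [if_neg hlt]
      have h1 := h U hU
      rw [← hk, ← Finset.sum_powerset_apply_card, ← h1]
      have hmem : U ∈ U.powerset := Finset.mem_powerset_self U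
      rw [← Finset.add_sum_erase _ _ hmem, ← Finset.add_sum_erase _ (fun m => e m.card) hmem]
      have h2 : ∑ x ∈ U.powerset.erase U, c x = ∑ x ∈ U.powerset.erase U, e x.card := by
        refine Finset.sum_congr rfl fun x hx => ?_
        obtain ⟨hne, hsub⟩ := Finset.mem_erase.1 hx
        rw [Finset.mem_powerset] at hsub
        refine he x (hsub.trans hU) ?_
        rw [← hk]
        exact Finset.card_lt_card (Finset.ssubset_iff_subset_ne.2 ⟨hsub, hne⟩)
      rw [h2]
      abel

/-- If `c` vanishes on sets of more than `d < p ^ k` elements and its sums over subsets of `B`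
depend only on the size of the subset, then, for `p ^ k ∣ |B|`, the sums over the subsets of `B`
and of `∅` agree modulo `p`. -/
theorem sum_powerset_eq_empty {α : Type*} [DecidableEq α] {p k d : ℕ} (hp : p.Prime)
    (hd : d < p ^ k) {B : Finset α} (hB : p ^ k ∣ B.card) {c : Finset α → ZMod p} {v : ℕ → ZMod p}
    (hc : ∀ U, d < U.card → c U = 0) (h : ∀ T ⊆ B, ∑ U ∈ T.powerset, c U = v T.card) :
    ∑ U ∈ B.powerset, c U = c ∅ := by
  obtain ⟨e, he⟩ := exists_eq_apply_card_of_sum_powerset h (B.card + 1)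
  have h1 : ∑ U ∈ B.powerset, c U = ∑ U ∈ B.powerset, e U.card := by
    refine Finset.sum_congr rfl fun U hU => ?_
    rw [Finset.mem_powerset] at hU
    exact he U hU (Nat.lt_succ_of_le (Finset.card_le_card hU))
  rw [h1, Finset.sum_powerset_apply_card, he ∅ (Finset.empty_subset _) (by simp)]
  rw [Finset.sum_eq_single 0]
  · simp
  · intro i hi hi0
    rw [Finset.mem_range] at hi
    -- For `0 < i ≤ d` the binomial coefficient vanishes modulo `p`; for `i > d` the coefficient `e
    -- i` itself is zero.
    by_cases hid : i ≤ d
    · have := prime_dvd_choose_of_pow_dvd hp hB (Nat.pos_of_ne_zero hi0) (by omega)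
      rw [nsmul_eq_mul, (ZMod.natCast_eq_zero_iff _ _).2 this, zero_mul]
    · obtain ⟨U, hU, hUc⟩ := Finset.exists_subset_card_eq (s := B) (n := i) (by omega)
      have := he U hU (by omega)
      rw [hc U (by omega), hUc] at this
      rw [← this, smul_zero]
  · intro h0
    simp at h0

/-! ### Permutations of `q`-power order and their orbits -/

/-- A sum modulo a prime `q` of a function that is invariant under a permutation of `q`-power order
and vanishes at its fixed points is zero. -/
theorem sum_eq_zero_of_perm_pow_prime {β : Type*} [Fintype β] [DecidableEq β] {q k : ℕ}
    (hq : q.Prime) (τ : Perm β) (hτ : τ ^ q ^ k = 1) (a : β → ZMod q) (ha : ∀ b, a (τ b) = a b)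
    (hfix : ∀ b, τ b = b → a b = 0) : ∑ b, a b = 0 := by
  have : Fact q.Prime := ⟨hq⟩
  classical
  -- Each fibre over a nonzero value is `τ`-invariant without fixed points, so its size is divisible
  -- by `q`.
  rw [← Finset.sum_fiberwise Finset.univ a a]
  refine Finset.sum_eq_zero fun v _ => ?_
  have h1 : ∑ b with a b = v, a b = ∑ b with a b = v, v :=
    Finset.sum_congr rfl fun b hb => (Finset.mem_filter.1 hb).2
  rw [h1, Finset.sum_const, nsmul_eq_mul]
  by_cases hv : v = 0
  · rw [hv, mul_zero]
  have hdvd : q ∣ (Finset.univ.filter fun b => a b = v).card := by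
    let f : Perm {b // a b = v} := τ.subtypePerm (fun b => by rw [ha])
    have hf : f ^ q ^ k = 1 := by
      rw [Perm.subtypePerm_pow]
      ext x
      simp [hτ]
    by_contra hnd
    rw [← Fintype.card_subtype] at hnd
    obtain ⟨x, hx⟩ := Perm.exists_fixed_point_of_prime hnd hf
    exact hv (x.2 ▸ hfix x.1 (congrArg Subtype.val hx))
  rw [(ZMod.natCast_eq_zero_iff _ _).2 hdvd, zero_mul]

/-- The permutations of the coordinates that leave a function on the cube invariant. -/
def cubeStabilizer {α R : Type*} (F : (α → Bool) → R) : Subgroup (Perm α) where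
  carrier := {π | ∀ x : α → Bool, F (x ∘ π) = F x}
  one_mem' := fun _ => rfl
  mul_mem' := by
    intro π ρ hπ hρ x
    have : x ∘ (π * ρ : Perm α) = (x ∘ π) ∘ ρ := rfl
    rw [this, hρ, hπ]
  inv_mem' := by
    intro π hπ x
    rw [← hπ (x ∘ (π⁻¹ : Perm α))]
    congr 1
    ext i
    simp

/-- An invariant set of `ρ` with fewer than `Q` elements contains no point all of whose return
times are multiples of `Q`. -/
theorem notMem_of_card_lt {α : Type*} {ρ : Perm α} {D : Finset α} {Q : ℕ}
    (hD : ∀ a ∈ D, ρ a ∈ D) (hcard : D.card < Q) {i : α} (hi : ∀ j, (ρ ^ j) i = i → Q ∣ j) :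
    i ∉ D := by
  intro hiD
  have hmem : ∀ j, (ρ ^ j) i ∈ D := by
    intro j
    induction j with
    | zero => simpa using hiD
    | succ j ih =>
      rw [pow_succ', Perm.mul_apply]
      exact hD _ ih
  have hlt : ∀ j k, j < k → k < Q → (ρ ^ j) i ≠ (ρ ^ k) i := by
    intro j k hjk hk e
    have h1 : (ρ ^ (k - j)) i = i := by
      apply (ρ ^ j).injective
      rw [← Perm.mul_apply, ← pow_add, Nat.add_sub_cancel' hjk.le, e]
    exact absurd (Nat.le_of_dvd (by omega) (hi _ h1)) (by omega)
  have := Finset.card_le_card_of_injOn (s := Finset.range Q) (t := D) (fun j => (ρ ^ j) i)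
    (fun j _ => hmem j) (by
      intro j hj k hk e
      simp only [Finset.coe_range, Set.mem_Iio] at hj hk
      rcases lt_trichotomy j k with h | h | h
      · exact absurd e (hlt j k h hk)
      · exact h
      · exact absurd e.symm (hlt k j h hj))
  rw [Finset.card_range] at this
  omega

/-- A permutation supported in `B` all of whose cycles on `B` have length `Q`. -/
theorem exists_perm_uniform_cycles {α : Type*} [DecidableEq α] {B : Finset α} {A Q : ℕ}
    (hQ : 0 < Q) (hB : B.card = A * Q) :
    ∃ ρ : Perm α, ρ ^ Q = 1 ∧ (∀ i, i ∉ B → ρ i = i) ∧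
      ∀ i ∈ B, ∀ j, (ρ ^ j) i = i → Q ∣ j := by
  have : NeZero Q := ⟨hQ.ne'⟩
  have e : {i // i ∈ B} ≃ Fin A × ZMod Q := Fintype.equivOfCardEq (by
    rw [Fintype.card_coe, Fintype.card_prod, Fintype.card_fin, ZMod.card, hB])
  let f : Perm {i // i ∈ B} :=
    (e.trans (Equiv.prodCongr (Equiv.refl (Fin A)) (Equiv.addRight (1 : ZMod Q)))).trans e.symm
  have hf : ∀ (j : ℕ) b, (f ^ j) b = e.symm ((e b).1, (e b).2 + (j : ZMod Q)) := by
    intro j b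
    induction j with
    | zero => simp
    | succ j ih =>
      rw [pow_succ', Perm.mul_apply, ih]
      simp [f, add_assoc]
  refine ⟨Perm.ofSubtype f, ?_, fun i hi => Perm.ofSubtype_apply_of_not_mem f hi, ?_⟩
  · rw [← map_pow]
    have : f ^ Q = 1 := by
      ext b
      rw [hf]
      simp
    rw [this, map_one]
  · intro i hi j hj
    rw [← map_pow, Perm.ofSubtype_apply_of_mem _ hi, hf] at hj
    have h1 : e.symm ((e ⟨i, hi⟩).1, (e ⟨i, hi⟩).2 + (j : ZMod Q)) = ⟨i, hi⟩ := Subtype.ext hj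
    rw [Equiv.symm_apply_eq] at h1
    have h2 := congrArg Prod.snd h1
    simp only [add_eq_left] at h2
    exact (ZMod.natCast_eq_zero_iff _ _).1 h2

/-! ### Symmetries of functions on the Boolean cube -/

section Cube

variable {α R : Type*} [Fintype α] [DecidableEq α]

/-- Two of the three Boolean values of `x` on the support of `g` coincide, so on this `x` the
transposition acts like `1`, `g` or `g⁻¹`. Which one depends on `x`. -/
theorem swap_apply_mem_cubeStabilizer {F : (α → Bool) → R} {g : Perm α}
    (hg : g ∈ cubeStabilizer F) (h3 : g.IsThreeCycle) {a : α} (ha : a ∈ g.support) :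
    swap a (g a) ∈ cubeStabilizer F := by
  intro x
  have hsupp := (Perm.IsThreeCycle.support_eq_iff_mem_support h3).2 ha
  have hcube : g (g (g a)) = a := by
    have : g ^ 3 = 1 := by rw [← h3.orderOf]; exact pow_orderOf_eq_one g
    simpa [pow_succ, Perm.mul_apply] using congrArg (fun k : Perm α => k a) this
  have hnd := (Perm.IsThreeCycle.nodup_iff_mem_support h3).2 ha
  have hfix : ∀ i, i ≠ a → i ≠ g a → i ≠ g (g a) → g i = i := fun i h1 h2 h3' => by
    rw [← Perm.notMem_support, hsupp]
    simp [h1, h2, h3']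
  simp only [List.nodup_cons, List.mem_cons, List.not_mem_nil, or_false, not_or] at hnd
  obtain ⟨⟨hab, hac⟩, hbc, -⟩ := hnd
  by_cases h1 : x a = x (g a)
  · congr 1
    ext i
    simp only [Function.comp_apply, swap_apply_def]
    split_ifs with e1 e2
    · rw [e1, h1]
    · rw [e2, h1]
    · rfl
  by_cases h2 : x (g (g a)) = x a
  · rw [← hg x]
    congr 1
    ext i
    simp only [Function.comp_apply, swap_apply_def]
    split_ifs with e1 e2
    · rw [e1]
    · rw [e2, h2]
    · by_cases e3 : i = g (g a)
      · rw [e3, hcube, h2]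
      · rw [hfix i e1 e2 e3]
  · have h4 : x (g (g a)) = x (g a) := by
      cases hx1 : x a <;> cases hx2 : x (g a) <;> cases hx3 : x (g (g a)) <;> simp_all
    rw [← (cubeStabilizer F).inv_mem hg x]
    congr 1
    ext i
    simp only [Function.comp_apply, swap_apply_def]
    split_ifs with e1 e2
    · have : g⁻¹ a = g (g a) := by rw [Perm.inv_eq_iff_eq, hcube]
      rw [e1, this, h4]
    · rw [e2]
      simp
    · by_cases e3 : i = g (g a)
      · rw [e3, h4]
        simp
      · have : g⁻¹ i = i := by rw [Perm.inv_eq_iff_eq, hfix i e1 e2 e3]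
        rw [this]

theorem swap_mem_cubeStabilizer {F : (α → Bool) → R} {a b : α}
    (hab : threeCycleSetoid (cubeStabilizer F) a b) : swap a b ∈ cubeStabilizer F := by
  rcases hab with rfl | ⟨g, hg, h3, ha, hb⟩
  · rw [swap_self]
    exact (cubeStabilizer F).one_mem
  · rw [(Perm.IsThreeCycle.support_eq_iff_mem_support h3).2 ha] at hb
    simp only [Finset.mem_insert, Finset.mem_singleton] at hb
    rcases hb with rfl | rfl | rfl
    · rw [swap_self]
      exact (cubeStabilizer F).one_mem
    · exact swap_apply_mem_cubeStabilizer hg h3 ha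
    · have hcube : g (g (g a)) = a := by
        have : g ^ 3 = 1 := by rw [← h3.orderOf]; exact pow_orderOf_eq_one g
        simpa [pow_succ, Perm.mul_apply] using congrArg (fun k : Perm α => k a) this
      have : g⁻¹ a = g (g a) := by rw [Perm.inv_eq_iff_eq, hcube]
      rw [← this]
      exact swap_apply_mem_cubeStabilizer ((cubeStabilizer F).inv_mem hg) h3.inv
        (by rwa [Perm.support_inv])

/-- A subgroup containing all transpositions of points of `K` contains all permutations
supported in `K`. -/
theorem mem_of_swap_mem {H : Subgroup (Perm α)} {K : Finset α}
    (hK : ∀ a ∈ K, ∀ b ∈ K, swap a b ∈ H) {g : Perm α} (hg : ∀ a, a ∉ K → g a = a) : g ∈ H := by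
  have key : ∀ f : Perm {x // x ∈ K}, Perm.ofSubtype f ∈ H := by
    intro f
    induction f using Perm.swap_induction_on with
    | one => rw [map_one]; exact H.one_mem
    | swap_mul f x y _ ih =>
      rw [map_mul, Perm.ofSubtype_swap_eq]
      exact H.mul_mem (hK x x.2 y y.2) ih
  have hsub : ∀ x, x ∈ K ↔ g x ∈ K := by
    intro x
    constructor
    · intro h
      by_contra h'
      rw [g.injective (hg _ h')] at h'
      exact h' h
    · intro h
      by_contra h'
      rw [hg _ h'] at h
      exact h' h
  have := key (g.subtypePerm fun x => (hsub x).symm)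
  rwa [Perm.ofSubtype_subtypePerm] at this
  intro x hx
  by_contra h
  exact hx (hg x h)

end Cube

/-! ### Circuit automorphisms -/

namespace AndModModCircuit

variable {n d p q : ℕ}

/-- The sum modulo `p` on the incoming wires of a `MOD_p` gate. -/
def modSum (C : AndModModCircuit n d p q) (h : Fin C.numMod) (x : Fin n → Bool) : ZMod p :=
  ((∑ g, C.midWires g h * (C.andValue x g).toNat : ℕ) : ZMod p)

/-- The permutations `π`, `σ`, `τ` of the inputs, the `AND` gates and the `MOD_p` gates form an
automorphism of the circuit. -/
def IsAutomorphism (C : AndModModCircuit n d p q) (π : Perm (Fin n)) (σ : Perm (Fin C.numAnd))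
    (τ : Perm (Fin C.numMod)) : Prop :=
  (∀ i g, C.inWires (π i) (σ g) = C.inWires i g) ∧
    (∀ g h, C.midWires (σ g) (τ h) = C.midWires g h) ∧
    (∀ h, C.outWires (τ h) = C.outWires h) ∧
    (∀ h, C.accept (τ h) = C.accept h)

variable {C : AndModModCircuit n d p q} {π : Perm (Fin n)} {σ : Perm (Fin C.numAnd)}
  {τ : Perm (Fin C.numMod)}

theorem IsAutomorphism.pow (h : C.IsAutomorphism π σ τ) (k : ℕ) :
    C.IsAutomorphism (π ^ k) (σ ^ k) (τ ^ k) := by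
  induction k with
  | zero => exact ⟨fun _ _ => rfl, fun _ _ => rfl, fun _ => rfl, fun _ => rfl⟩
  | succ k ih =>
    obtain ⟨h1, h2, h3, h4⟩ := h
    obtain ⟨k1, k2, k3, k4⟩ := ih
    simp only [pow_succ', IsAutomorphism, Perm.mul_apply]
    exact ⟨fun i g => by rw [h1, k1], fun g h => by rw [h2, k2], fun h => by rw [h3, k3],
      fun h => by rw [h4, k4]⟩

theorem IsAutomorphism.andValue_apply (h : C.IsAutomorphism π σ τ) (x : Fin n → Bool)
    (g : Fin C.numAnd) : C.andValue x (σ g) = C.andValue (x ∘ π) g := by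
  unfold andValue
  congr 1
  refine propext ((Equiv.forall_congr_right π).symm.trans (forall_congr' fun i => ?_))
  rw [h.1]
  rfl

theorem IsAutomorphism.modSum_apply (h : C.IsAutomorphism π σ τ) (x : Fin n → Bool)
    (k : Fin C.numMod) : C.modSum (τ k) x = C.modSum k (x ∘ π) := by
  unfold modSum
  congr 1
  rw [← Equiv.sum_comp σ]
  exact Finset.sum_congr rfl fun g _ => by rw [h.2.1, h.andValue_apply]

theorem IsAutomorphism.modValue_apply (h : C.IsAutomorphism π σ τ) (x : Fin n → Bool)
    (k : Fin C.numMod) : C.modValue x (τ k) = C.modValue (x ∘ π) k := by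
  have := h.modSum_apply x k
  unfold modSum at this
  unfold modValue
  rw [this, h.2.2.2]

theorem IsAutomorphism.eval_comp (h : C.IsAutomorphism π σ τ) (x : Fin n → Bool) :
    C.eval (x ∘ π) = C.eval x := by
  unfold eval
  rw [← Equiv.sum_comp τ (fun k => C.outWires k * (C.modValue x k).toNat)]
  simp only [h.modValue_apply, h.2.2.1]

theorem IsSymmetric.dependsOnWeight (hC : C.IsSymmetric) : DependsOnWeight C.eval := by
  intro x y hxy
  obtain ⟨g, -, hg⟩ := exists_perm_map_eq (W := Finset.univ)
    (V := Finset.univ.filter fun i => x i = true) (V' := Finset.univ.filter fun i => y i = true)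
    (Finset.subset_univ _) (Finset.subset_univ _) hxy
  obtain ⟨σ, τ, h⟩ := hC g
  have hx : x = y ∘ g := by
    ext i
    have := hg i
    simp only [Finset.mem_filter, Finset.mem_univ, true_and] at this
    rw [Function.comp_apply, Bool.eq_iff_iff, this]
  rw [hx]
  exact IsAutomorphism.eval_comp (C := C) h y

/-- An orbit bound without a group action: lifts of input permutations are chosen arbitrarily, but
two permutations whose lifts send `h` to the same gate differ by a stabilizer element. -/
theorem IsSymmetric.index_cubeStabilizer_le (hC : C.IsSymmetric) (h : Fin C.numMod) :
    (cubeStabilizer (C.modSum h)).index ≤ C.numMod := by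
  choose σ τ haut using hC
  have : Nat.card (Perm (Fin n) ⧸ cubeStabilizer (C.modSum h)) ≤ Nat.card (Fin C.numMod) := by
    refine Nat.card_le_card_of_injective (fun c => τ c.out h) ?_
    intro c c' hcc
    rw [← QuotientGroup.out_eq' c, ← QuotientGroup.out_eq' c', QuotientGroup.eq]
    intro x
    have h1 := IsAutomorphism.modSum_apply (C := C) (haut c.out) (x ∘ (c.out⁻¹ : Perm (Fin n))) h
    have h2 := IsAutomorphism.modSum_apply (C := C) (haut c'.out) (x ∘ (c.out⁻¹ : Perm (Fin n))) h
    simp only at hcc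
    rw [hcc, h2] at h1
    have e1 : (x ∘ (c.out⁻¹ : Perm (Fin n))) ∘ (c.out : Perm (Fin n)) = x := by
      ext i; simp
    rw [e1] at h1
    exact h1
  simpa [Subgroup.index] using this

/-! ### Periodicity -/

/-- On a subcube with free coordinates `B`, the sum at a `MOD_p` gate is invariant under switching
on all of `B`, provided that it is symmetric in these coordinates and `p ^ k ∣ |B|` for a power
`p ^ k > d`. -/
theorem modSum_eq_of_symmetric (hp : p.Prime) {k : ℕ} (hd : d < p ^ k) (h : Fin C.numMod)
    {B : Finset (Fin n)} (hB : p ^ k ∣ B.card)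
    (hsymm : ∀ g : Perm (Fin n), (∀ a, a ∉ B → g a = a) → g ∈ cubeStabilizer (C.modSum h))
    {x y : Fin n → Bool} (hx : ∀ i ∈ B, x i = false) (hy : ∀ i ∈ B, y i = true)
    (hxy : ∀ i, i ∉ B → y i = x i) : C.modSum h y = C.modSum h x := by
  classical
  let S : Fin C.numAnd → Finset (Fin n) := fun g => Finset.univ.filter fun i => C.inWires i g ≠ 0
  let z : Finset (Fin n) → Fin n → Bool := fun T i => x i || decide (i ∈ T)
  -- `c U` is the coefficient of the monomial `∏ i ∈ U, x_i` of the sum restricted to the subcube: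
  -- an `AND` gate contributes to `U = S g ∩ B` if its inputs outside `B` are all true.
  let c : Finset (Fin n) → ZMod p := fun U => ∑ g, if S g ∩ B = U then
    (if ∀ i ∈ S g \ B, x i = true then (C.midWires g h : ZMod p) else 0) else 0
  have hand : ∀ T ⊆ B, ∀ g, C.andValue (z T) g = true ↔
      S g ∩ B ⊆ T ∧ ∀ i ∈ S g \ B, x i = true := by
    intro T hT g
    simp only [andValue, decide_eq_true_eq, z, S, Bool.or_eq_true]
    constructor
    · intro H
      refine ⟨fun i hi => ?_, fun i hi => ?_⟩
      · simp only [Finset.mem_inter, Finset.mem_filter, Finset.mem_univ, true_and] at hi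
        rcases H i hi.1 with h1 | h1
        · rw [hx i hi.2] at h1
          exact absurd h1 (by simp)
        · exact h1
      · simp only [Finset.mem_sdiff, Finset.mem_filter, Finset.mem_univ, true_and] at hi
        exact (H i hi.1).resolve_right fun h1 => hi.2 (hT h1)
    · rintro ⟨H1, H2⟩ i hi
      by_cases hiB : i ∈ B
      · exact Or.inr (H1 (by simp [hi, hiB]))
      · exact Or.inl (H2 i (by simp [hi, hiB]))
  have hsum : ∀ T ⊆ B, ∑ U ∈ T.powerset, c U = C.modSum h (z T) := by
    intro T hT
    simp only [c, modSum]
    rw [Finset.sum_comm, Nat.cast_sum]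
    refine Finset.sum_congr rfl fun g _ => ?_
    rw [Finset.sum_ite_eq]
    simp only [Finset.mem_powerset]
    have := hand T hT g
    by_cases h1 : S g ∩ B ⊆ T
    · by_cases h2 : ∀ i ∈ S g \ B, x i = true
      · rw [if_pos h1, if_pos h2, this.2 ⟨h1, h2⟩]
        simp
      · have h3 : C.andValue (z T) g = false := by
          rw [← Bool.not_eq_true, this]
          exact fun h' => h2 h'.2
        rw [if_pos h1, if_neg h2, h3]
        simp
    · have h3 : C.andValue (z T) g = false := by
        rw [← Bool.not_eq_true, this]
        exact fun h' => h1 h'.1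
      rw [if_neg h1, h3]
      simp
  have hcard : ∀ T ⊆ B, ∀ T' ⊆ B, T.card = T'.card → C.modSum h (z T) = C.modSum h (z T') := by
    intro T hT T' hT' hTT
    obtain ⟨g, hgB, hg⟩ := exists_perm_map_eq hT hT' hTT
    rw [← hsymm g hgB (z T')]
    congr 1
    ext i
    simp only [z, Function.comp_apply, hg]
    congr 1
    by_cases hi : i ∈ B
    · have hgi : g i ∈ B := by
        by_contra h'
        rw [g.injective (hgB _ h')] at h'
        exact h' hi
      rw [hx i hi, hx _ hgi]
    · rw [hgB i hi]
  -- The default `0` occurs only for `m > |B|`.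
  let v : ℕ → ZMod p := fun m =>
    if hm : ∃ T ⊆ B, T.card = m then C.modSum h (z hm.choose) else 0
  have hv : ∀ T ⊆ B, ∑ U ∈ T.powerset, c U = v T.card := by
    intro T hT
    have hm : ∃ T' ⊆ B, T'.card = T.card := ⟨T, hT, rfl⟩
    rw [hsum T hT]
    simp only [v, dif_pos hm]
    exact hcard T hT _ hm.choose_spec.1 hm.choose_spec.2.symm
  have hc : ∀ U, d < U.card → c U = 0 := by
    intro U hU
    refine Finset.sum_eq_zero fun g _ => if_neg ?_
    rintro rfl
    have h1 := C.andFanIn g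
    have h2 : (S g ∩ B).card ≤ (S g).card := Finset.card_le_card Finset.inter_subset_left
    exact absurd (h2.trans h1) (by omega)
  have hfin := sum_powerset_eq_empty hp hd hB hc hv
  have hempty := hsum ∅ (Finset.empty_subset _)
  rw [Finset.powerset_empty, Finset.sum_singleton] at hempty
  rw [hsum B (Finset.Subset.refl _), hempty] at hfin
  have hzB : z B = y := by
    ext i
    by_cases hi : i ∈ B
    · simp [z, hi, hy i hi]
    · simp [z, hi, hxy i hi]
  have hz0 : z ∅ = x := by
    ext i
    simp [z]
  rwa [hzB, hz0] at hfin

/-- An automorphism over an input permutation of `q`-power order can be chosen to have `q`-power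
order on the `MOD_p` gates. -/
theorem IsSymmetric.exists_automorphism (hC : C.IsSymmetric) (hq : q.Prime) {ρ : Perm (Fin n)}
    {k : ℕ} (hρ : ρ ^ q ^ k = 1) :
    ∃ σ τ, C.IsAutomorphism ρ σ τ ∧ ∃ a, τ ^ q ^ a = 1 := by
  obtain ⟨σ, τ, h⟩ := hC ρ
  obtain ⟨a, b, hb, hab⟩ := Nat.exists_eq_pow_mul_and_not_dvd (orderOf_pos τ).ne' q hq.ne_one
  have hcop : Nat.Coprime b (q ^ k) :=
    Nat.Coprime.pow_right k ((Nat.Prime.coprime_iff_not_dvd hq).2 hb).symm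
  have hmod := Nat.ModEq.pow_totient hcop
  -- `u` is `1` modulo `q ^ k` and divisible by the `q`-free part `b` of the order of `τ`: raising
  -- to the power `u` keeps `ρ` and leaves `τ` with `q`-power order.
  set u := b ^ Nat.totient (q ^ k) with hu
  have hρu : ρ ^ u = ρ := by
    have h1 : orderOf ρ ∣ q ^ k := orderOf_dvd_of_pow_eq_one hρ
    conv_rhs => rw [← pow_one ρ]
    exact pow_eq_pow_iff_modEq.2 (hmod.of_dvd h1)
  have hbu : b ∣ u :=
    dvd_pow_self b (Nat.totient_pos.2 (pow_pos hq.pos k)).ne'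
  refine ⟨σ ^ u, τ ^ u, ?_, a, ?_⟩
  · have := IsAutomorphism.pow (C := C) h u
    rwa [hρu] at this
  · rw [← pow_mul, ← orderOf_dvd_iff_pow_eq_one, hab, mul_comm u]
    exact Nat.mul_dvd_mul_left _ hbu

theorem IsSymmetric.isWeightPeriod (hC : C.IsSymmetric) (hp : p.Prime) (hq : q.Prime)
    (hn : 13 ≤ n) (hs : C.size ^ 9 < 2 ^ n) {kp kq : ℕ} (hd : d < p ^ kp)
    (hlog : ∀ k, 2 ^ k ≤ C.size → k < q ^ kq) : IsWeightPeriod C.eval (p ^ kp * q ^ kq) := by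
  refine ⟨Nat.mul_pos (pow_pos hp.pos _) (pow_pos hq.pos _), fun m hm => ?_⟩
  have : Fact q.Prime := ⟨hq⟩
  set r := p ^ kp * q ^ kq with hr
  let B : Finset (Fin n) := Finset.univ.filter fun i => m ≤ (i : ℕ) ∧ (i : ℕ) < m + r
  have hBmem : ∀ i : Fin n, i ∈ B ↔ m ≤ (i : ℕ) ∧ (i : ℕ) < m + r := fun i => by simp [B]
  have hB : B.card = r := by
    have h1 : B.map Fin.valEmbedding = Finset.Ico m (m + r) := by
      ext j
      simp only [Finset.mem_map, hBmem, Fin.valEmbedding_apply, Finset.mem_Ico]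
      exact ⟨by rintro ⟨i, hi, rfl⟩; exact hi, fun hj => ⟨⟨j, by omega⟩, hj, rfl⟩⟩
    rw [← Finset.card_map Fin.valEmbedding, h1, Nat.card_Ico]
    omega
  obtain ⟨ρ, hρ1, hρB, hρorb⟩ := exists_perm_uniform_cycles (pow_pos hq.pos kq) (hB.trans hr)
  obtain ⟨σ, τ, haut, a, hτ⟩ := hC.exists_automorphism hq hρ1
  have hρmem : ∀ i ∈ B, ρ i ∈ B := fun i hi => by
    by_contra h'
    rw [ρ.injective (hρB _ h')] at h'
    exact h' hi
  set x := onesZeros n m with hx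
  set y := onesZeros n (m + r) with hy
  have hxB : ∀ i ∈ B, x i = false := fun i hi => by
    have := (hBmem i).1 hi
    simp only [hx, onesZeros, decide_eq_false_iff_not]
    omega
  have hyB : ∀ i ∈ B, y i = true := fun i hi => by
    have := (hBmem i).1 hi
    simp only [hy, onesZeros, decide_eq_true_eq]
    omega
  have hxy : ∀ i, i ∉ B → y i = x i := fun i hi => by
    rw [hBmem] at hi
    simp only [hx, hy, onesZeros, decide_eq_decide]
    omega
  have hxρ : x ∘ ρ = x := by
    ext i
    by_cases hi : i ∈ B
    · rw [Function.comp_apply, hxB _ (hρmem i hi), hxB i hi]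
    · rw [Function.comp_apply, hρB i hi]
  have hyρ : y ∘ ρ = y := by
    ext i
    by_cases hi : i ∈ B
    · rw [Function.comp_apply, hyB _ (hρmem i hi), hyB i hi]
    · rw [Function.comp_apply, hρB i hi]
  have hfix : ∀ h, τ h = h → C.modValue y h = C.modValue x h := by
    intro h hh
    have hρH : ρ ∈ cubeStabilizer (C.modSum h) := fun w => by
      rw [← haut.modSum_apply, hh]
    have hidx : (cubeStabilizer (C.modSum h)).index ≤ C.size :=
      (hC.index_cubeStabilizer_le h).trans (by unfold size; omega)
    obtain ⟨D, hD2, hDinv, hDrel⟩ := exists_large_invariant_class (cubeStabilizer (C.modSum h))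
      hidx (by simpa using hn) (by simpa using hs)
    -- `D` is `ρ`-invariant and smaller than every cycle of `ρ` on `B`.
    have hBD : ∀ i ∈ B, i ∉ D := fun i hi =>
      notMem_of_card_lt (hDinv ρ hρH) (hlog _ hD2) (hρorb i hi)
    have hsum : C.modSum h y = C.modSum h x :=
      modSum_eq_of_symmetric hp hd h (hB ▸ Dvd.intro _ hr.symm)
        (fun g hg => mem_of_swap_mem
          (fun i hi j hj => swap_mem_cubeStabilizer (hDrel i j (hBD i hi) (hBD j hj))) hg)
        hxB hyB hxy
    unfold modSum at hsum
    unfold modValue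
    rw [hsum]
  -- The differences between `y` and `x` are `τ`-invariant because `ρ` fixes both inputs, and vanish
  -- at gates fixed by `τ`.
  have hzero := sum_eq_zero_of_perm_pow_prime hq τ hτ
    (fun h => (C.outWires h : ZMod q) * (((C.modValue y h).toNat : ZMod q) -
      ((C.modValue x h).toNat : ZMod q)))
    (fun h => by
      simp only [haut.modValue_apply, haut.2.2.1, hxρ, hyρ])
    (fun h hh => by simp only [hfix h hh, sub_self, mul_zero])
  simp only [mul_sub, Finset.sum_sub_distrib, sub_eq_zero] at hzero
  unfold eval
  push_cast
  rw [hzero]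

end AndModModCircuit

theorem theorem1 (p q : ℕ) (hp : p.Prime) (hq : q.Prime) (n d : ℕ) (hn : 13 ≤ n)
    (hd1 : 1 ≤ d) (hdn : d ≤ n) (C : AndModModCircuit n d p q) (hC : C.IsSymmetric)
    (hs : (C.size : ℝ) < (2 : ℝ) ^ ((n : ℝ) / 9)) :
    DependsOnWeight C.eval ∧
      ∀ kp kq : ℕ, d < p ^ kp → Real.logb 2 (C.size : ℝ) + 1 < (q : ℝ) ^ kq →
        IsWeightPeriod C.eval (p ^ kp * q ^ kq) := by
  refine ⟨hC.dependsOnWeight, fun kp kq hkp hkq => hC.isWeightPeriod hp hq hn ?_ hkp ?_⟩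
  · have h1 : (C.size : ℝ) ^ 9 < ((2 : ℝ) ^ ((n : ℝ) / 9)) ^ 9 :=
      pow_lt_pow_left₀ hs (Nat.cast_nonneg _) (by norm_num)
    rw [← Real.rpow_natCast (_ ^ ((n : ℝ) / 9)), ← Real.rpow_mul (by norm_num)] at h1
    have h2 : (n : ℝ) / 9 * ((9 : ℕ) : ℝ) = n := by
      push_cast
      ring
    rw [h2, Real.rpow_natCast] at h1
    exact_mod_cast h1
  · intro k hk
    have hpos : (0 : ℝ) < C.size := by
      have : 0 < C.size := by unfold AndModModCircuit.size; omega
      exact_mod_cast this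
    have h1 : (k : ℝ) ≤ Real.logb 2 C.size := by
      rw [Real.le_logb_iff_rpow_le (by norm_num) hpos, Real.rpow_natCast]
      exact_mod_cast hk
    have h2 : (k : ℝ) < (q : ℝ) ^ kq := by linarith
    exact_mod_cast h2
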